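/- Let $S$ be a set and let $\Sigma$ be an $S$-sorted signature, i.e. a set $\Sigma$ of operation symbols with an arity function $(s,t)\colon \Sigma \to S^* \times S$, where $S^*$ is the set of finite words over $S$. A $\Sigma$-algebra is an $S$-sorted set $A=(A_x)_{x\in S}$ with, for each $\sigma\in\Sigma$ with $s(\sigma)=x_0\cdots x_{n-1}$, an operation $\sigma^A\colon A_{x_0}\times\cdots\times A_{x_{n-1}}\to A_{t(\sigma)}$; homomorphisms are the $S$-sorted functions commuting with all operations. Let $\Sigma\text{-}\mathrm{Alg}$ be the resulting category, with forgetful functor $U\colon \Sigma\text{-}\mathrm{Alg}\to \mathrm{Set}^S$, and let $\hat s,\hat t\colon \mathrm{Set}^S\to \mathrm{Set}^\Sigma$ be the functors $$\hat s(A)=(A_{x_0}\times\cdots\times A_{x_{n-1}})_{\sigma\in\Sigma,\ s(\sigma)=x_0\cdots x_{n-1}},\qquad \hat t(A)=(A_{t(\sigma)})_{\sigma\in\Sigma}.$$ For parallel functors $F,G\colon\mathcal A\to\mathcal B$, let $\mathbf{Ins}(F,G)$ be the category of pairs $(A,r)$ with $r\colon FA\to GA$, whose morphisms $(A,r)\to(B,q)$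 are the morphisms $d\colon A\to B$ of $\mathcal A$ with $q\circ Fd=Gd\circ r$. A locally small category is algebraic if it is equivalent to the category $\mathrm{Alg}\,\mathcal T$ of finite-product-preserving functors $\mathcal T\to \mathrm{Set}$, for some small category $\mathcal T$ with finite products. Then: 1. $\Sigma\text{-}\mathrm{Alg}$, with $U$ and the natural transformation $\lambda\colon \hat s U\to\hat t U$, $\lambda_A=(\sigma^A)_{\sigma\in\Sigma}$, is an inserter from $\hat s$ to $\hat t$: for every functor $V\colon\mathcal D\to \mathrm{Set}^S$ and natural transformation $\alpha\colon \hat s V\to\hat t V$ there is a unique functor $W\colon\mathcal D\to\Sigma\text{-}\mathrm{Alg}$ with $V=UW$ and $\alpha=\lambda W$. 2. $\Sigma\text{-}\mathrm{Alg}$ and $\mathbf{Ins}(\hat s,\hat t)$ are isomorphic as concrete categories over $\mathrm{Set}^S$. 3. $\mathbf{Ins}(\hat s,\hat t)$, and hence $\Sigma\text{-}\mathrm{Alg}$, is an algebraic category. -/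

import Mathlib

open CategoryTheory CategoryTheory.Limits

universe w' w v₁ v₂ v₃ u₁ u₂ u₃ u

namespace InserterCat

section Inserter

variable {𝒜 : Type u₁} [Category.{v₁} 𝒜] {ℬ : Type u₂} [Category.{v₂} ℬ]

/-- An object of the inserter category `Ins(F, G)`: a pair `(A, r)` with `r : F A ⟶ G A`. -/
structure Ins (F G : 𝒜 ⥤ ℬ) where
  /-- The underlying object. -/
  obj : 𝒜
  /-- The structure morphism. -/
  str : F.obj obj ⟶ G.obj obj

namespace Ins

variable {F G : 𝒜 ⥤ ℬ}

/-- A morphism `(A, r) ⟶ (B, s)` of `Ins(F, G)`: a morphism `d : A ⟶ B` such that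
`s ∘ F d = G d ∘ r`. -/
@[ext]
structure Hom (X Y : Ins F G) where
  /-- The underlying morphism. -/
  hom : X.obj ⟶ Y.obj
  comm : F.map hom ≫ Y.str = X.str ≫ G.map hom

instance : Category (Ins F G) where
  Hom X Y := Hom X Y
  id X := ⟨𝟙 X.obj, by simp⟩
  comp f g := ⟨f.hom ≫ g.hom, by
    rw [F.map_comp, G.map_comp, Category.assoc, g.comm, ← Category.assoc, f.comm,
      Category.assoc]⟩
  id_comp f := Hom.ext (Category.id_comp f.hom)
  comp_id f := Hom.ext (Category.comp_id f.hom)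
  assoc f g h := Hom.ext (Category.assoc f.hom g.hom h.hom)

variable (F G) in
/-- The forgetful functor `U : Ins(F, G) ⥤ 𝒜`. -/
def forget : Ins F G ⥤ 𝒜 where
  obj X := X.obj
  map f := f.hom
  map_id _ := rfl
  map_comp _ _ := rfl

end Ins

/-- `(𝒱, U, lam)`, with `lam : F U ⟶ G U`, is an inserter from `F` to `G`: for every functor
`V : 𝒟 ⥤ 𝒜` and natural transformation `α : F V ⟶ G V` there is a unique functor `W : 𝒟 ⥤ 𝒱`
with `V = U W` and `α = lam W`. The morphisms `eqToHom` only identify `F V` with `F U W` and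
`G U W` with `G V` along the equality `U W = V`. The category `𝒟` ranges over all categories
with objects in `Type w'` and morphisms in `Type w`. -/
def IsInserter {𝒱 : Type u₃} [Category.{v₃} 𝒱] {F G : 𝒜 ⥤ ℬ} (U : 𝒱 ⥤ 𝒜)
    (lam : U ⋙ F ⟶ U ⋙ G) : Prop :=
  ∀ (𝒟 : Type w') [Category.{w} 𝒟] (V : 𝒟 ⥤ 𝒜) (α : V ⋙ F ⟶ V ⋙ G),
    ∃! W : 𝒟 ⥤ 𝒱, ∃ h : W ⋙ U = V,
      α = eqToHom (congrArg (fun K : 𝒟 ⥤ 𝒜 => K ⋙ F) h.symm) ≫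
        Functor.whiskerLeft W lam ≫ eqToHom (congrArg (fun K : 𝒟 ⥤ 𝒜 => K ⋙ G) h)

/-- Two categories with functors to `𝒜` are concretely isomorphic over `𝒜` if there is an
isomorphism of categories commuting with these functors. -/
def ConcretelyIsomorphic {𝒱 : Type u₂} [Category.{v₂} 𝒱] {𝒲 : Type u₃} [Category.{v₃} 𝒲]
    (U : 𝒱 ⥤ 𝒜) (U' : 𝒲 ⥤ 𝒜) : Prop :=
  ∃ (Φ : 𝒱 ⥤ 𝒲) (Ψ : 𝒲 ⥤ 𝒱), Φ ⋙ Ψ = 𝟭 𝒱 ∧ Ψ ⋙ Φ = 𝟭 𝒲 ∧ Φ ⋙ U' = U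

end Inserter

/-- `Alg 𝒯`: the full subcategory of the functor category `𝒯 ⥤ Set` on the functors that
preserve finite products. -/
abbrev AlgOver (𝒯 : Type u) [SmallCategory 𝒯] :=
  ObjectProperty.FullSubcategory (fun F : 𝒯 ⥤ Type u => PreservesFiniteProducts F)

/-- A locally small category is algebraic if it is equivalent to `Alg 𝒯` for some algebraic theory `𝒯`,
that is, for some small category `𝒯` with finite products. -/
def IsAlgebraicCategory (𝒜 : Type u₁) [Category.{u} 𝒜] : Prop :=
  ∃ (𝒯 : Type u) (_ : SmallCategory 𝒯) (_ : HasFiniteProducts 𝒯), Nonempty (𝒜 ≌ AlgOver 𝒯)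

/-- An `S`-sorted signature: a set of operation symbols, with an arity function to `S* × S`. -/
structure Signature (S : Type u) where
  /-- The operation symbols. -/
  Op : Type u
  /-- The arity function. -/
  arity : Op → List S × S

namespace Signature

variable {S : Type u}

/-- The source word of an operation symbol. -/
def src (Sg : Signature S) (σ : Sg.Op) : List S := (Sg.arity σ).1

/-- The target sort of an operation symbol. -/
def tgt (Sg : Signature S) (σ : Sg.Op) : S := (Sg.arity σ).2

end Signature

/-- For an `S`-sorted set `A` and a word `l = s₀ ⋯ sₙ₋₁`, the set `A_{s₀} × ⋯ × A_{sₙ₋₁}`. -/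
abbrev Tuple {S : Type u} (A : S → Type u) (l : List S) : Type u :=
  ∀ i : Fin l.length, A (l.get i)

/-- A `Σ`-algebra: an `S`-sorted set `A` with, for every operation symbol `σ` of arity
`(s₀ ⋯ sₙ₋₁, s)`, an operation `A_{s₀} × ⋯ × A_{sₙ₋₁} → A_s`. -/
structure SigAlg {S : Type u} (Sg : Signature S) where
  /-- The underlying `S`-sorted set. -/
  carrier : S → Type u
  /-- The operations. -/
  op : ∀ σ : Sg.Op, Tuple carrier (Sg.src σ) → carrier (Sg.tgt σ)

namespace SigAlg

variable {S : Type u} {Sg : Signature S}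

/-- A homomorphism of `Σ`-algebras: an `S`-sorted function that commutes with the operations. -/
@[ext]
structure Hom (A B : SigAlg Sg) where
  /-- The underlying `S`-sorted function. -/
  hom : A.carrier ⟶ B.carrier
  map_op : ∀ (σ : Sg.Op) (x : Tuple A.carrier (Sg.src σ)),
    hom (Sg.tgt σ) (A.op σ x) = B.op σ (fun i => hom ((Sg.src σ).get i) (x i))

instance : Category (SigAlg Sg) where
  Hom A B := Hom A B
  id A := ⟨𝟙 A.carrier, fun _ _ => rfl⟩
  comp f g := ⟨f.hom ≫ g.hom, fun σ x => by
    simp only [Pi.comp_apply, types_comp_apply, f.map_op, g.map_op]⟩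
  id_comp f := Hom.ext (Category.id_comp f.hom)
  comp_id f := Hom.ext (Category.comp_id f.hom)
  assoc f g h := Hom.ext (Category.assoc f.hom g.hom h.hom)

variable (Sg) in
/-- The forgetful functor from `Σ`-algebras to `S`-sorted sets. -/
def forget : SigAlg Sg ⥤ (S → Type u) where
  obj A := A.carrier
  map f := f.hom
  map_id _ := rfl
  map_comp _ _ := rfl

end SigAlg

section Functors

variable {S : Type u}

/-- The functor `Set^S ⥤ Set^{S*}`, `A ↦ A* = (A_{s₀} × ⋯ × A_{sₙ₋₁})_{s₀ ⋯ sₙ₋₁}`. -/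
def star : (S → Type u) ⥤ (List S → Type u) where
  obj A l := Tuple A l
  map f l := TypeCat.ofHom fun x i => f (l.get i) (x i)
  map_id _ := rfl
  map_comp _ _ := rfl

/-- The functor `ŝ : Set^S ⥤ Set^Σ`, sending `A` to the family of the
`A_{s₀} × ⋯ × A_{sₙ₋₁}`, where `s₀ ⋯ sₙ₋₁` is the source word of `σ`. -/
def sHat (Sg : Signature S) : (S → Type u) ⥤ (Sg.Op → Type u) :=
  star ⋙ Pi.comap (fun _ : List S => Type u) Sg.src

/-- The functor `t̂ : Set^S ⥤ Set^Σ`, sending `A` to the family of the `A_s`, where `s` is the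
target sort of `σ`. -/
def tHat (Sg : Signature S) : (S → Type u) ⥤ (Sg.Op → Type u) :=
  Pi.comap (fun _ : S => Type u) Sg.tgt

/-- The natural transformation whose component at a `Σ`-algebra is the family of its
operations. -/
def SigAlg.operations (Sg : Signature S) :
    SigAlg.forget Sg ⋙ sHat Sg ⟶ SigAlg.forget Sg ⋙ tHat Sg where
  app A σ := TypeCat.ofHom (A.op σ)
  naturality A B f := by
    funext σ
    ext x
    exact (SigAlg.Hom.map_op f σ x).symm

end Functors

end InserterCat

namespace InserterCat

/-! ### Inserter property and concrete isomorphism. -/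

section Inserter

variable {S : Type u} (Sg : Signature S)

/-! A family of operations on `A` is the same data as a morphism `ŝ A ⟶ t̂ A`, and the homomorphism
law is the commuting square read at each symbol. Hence the first two claims hold by unfolding. For
algebraicity, the theory is the opposite of the category of free algebras on finite sorted contexts,
and `A` goes to the model `Hom(-, A)`. Contexts have finite products by concatenation
(`prodIsLimit`), since homomorphisms out of a free algebra are determined by the variables
(`free_hom_ext`). The functor is full and faithful because elements of `A` are homomorphisms from
one-generator free algebras, and naturality along terms controls everything else
(`natTrans_app_hom`). It is essentially surjective because a product-preserving `M` is determined by
its values on single variables. These carry an algebra structure in which terms evaluate through `M`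
(`homOfElement_apply`). -/

theorem SigAlg.isInserter :
    IsInserter.{w', w} (F := sHat Sg) (G := tHat Sg) (SigAlg.forget Sg)
      (SigAlg.operations Sg) := by
  intro 𝒟 _ V α
  refine ⟨{ obj := fun D => ⟨V.obj D, fun σ x => α.app D σ x⟩
            map := fun {D E} f => ⟨V.map f, fun σ x =>
              (ConcreteCategory.congr_hom (congrFun (α.naturality f) σ) x).symm⟩
            map_id := fun D => SigAlg.Hom.ext (V.map_id D)
            map_comp := fun f g => SigAlg.Hom.ext (V.map_comp f g) }, ⟨rfl, ?_⟩, ?_⟩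
  · ext D
    rfl
  -- Once `V` is replaced by `W ⋙ U`, the transports are identities and eta for structures
  -- identifies the two functors.
  · rintro W ⟨rfl, hα⟩
    simp only [eqToHom_refl, Category.id_comp, Category.comp_id] at hα
    subst hα
    rfl

/-- The comparison functor from `Σ`-algebras to the inserter category. -/
def SigAlg.toIns : SigAlg Sg ⥤ Ins (sHat Sg) (tHat Sg) where
  obj A := ⟨A.carrier, fun σ => TypeCat.ofHom (A.op σ)⟩
  map f := ⟨f.hom, (SigAlg.operations Sg).naturality f⟩
  map_id _ := rfl
  map_comp _ _ := rfl

/-- The comparison functor from the inserter category to `Σ`-algebras. -/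
def SigAlg.ofIns : Ins (sHat Sg) (tHat Sg) ⥤ SigAlg Sg where
  obj X := ⟨X.obj, fun σ x => X.str σ x⟩
  map f := ⟨f.hom, fun σ x => (ConcreteCategory.congr_hom (congrFun f.comm σ) x).symm⟩
  map_id _ := rfl
  map_comp _ _ := rfl

theorem SigAlg.concretelyIsomorphic_ins :
    ConcretelyIsomorphic (SigAlg.forget Sg) (Ins.forget (sHat Sg) (tHat Sg)) :=
  ⟨SigAlg.toIns Sg, SigAlg.ofIns Sg, rfl, rfl, rfl⟩

/-- The equivalence between the inserter category and `Σ`-algebras. -/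
def SigAlg.insEquivalence : Ins (sHat Sg) (tHat Sg) ≌ SigAlg Sg :=
  .mk (SigAlg.ofIns Sg) (SigAlg.toIns Sg) (Iso.refl _) (Iso.refl _)

theorem IsAlgebraicCategory.of_equivalence {𝒜 : Type u₁} [Category.{u} 𝒜] {ℬ : Type u₂}
    [Category.{u} ℬ] (e : 𝒜 ≌ ℬ) (h : IsAlgebraicCategory ℬ) : IsAlgebraicCategory 𝒜 := by
  obtain ⟨𝒯, i, j, ⟨e'⟩⟩ := h
  exact ⟨𝒯, i, j, ⟨e.trans e'⟩⟩

end Inserter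

/-! ### Terms and free algebras. -/

section Terms

variable {S : Type u} {Sg : Signature S}

/-- The terms of a signature in the variables `i : ι`, the variable `i` having sort `sort i`. -/
inductive Term (Sg : Signature S) {ι : Type} (sort : ι → S) : S → Type u
  /-- A variable. -/
  | var (i : ι) : Term Sg sort (sort i)
  /-- An operation symbol applied to terms. -/
  | op (σ : Sg.Op) (t : ∀ i : Fin (Sg.src σ).length, Term Sg sort ((Sg.src σ).get i)) :
      Term Sg sort (Sg.tgt σ)

namespace Term

variable {ι : Type} {sort : ι → S}

/-- The value of a term in an algebra under an assignment of values to the variables. -/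
def eval (A : SigAlg Sg) (x : ∀ i, A.carrier (sort i)) : ∀ {s : S}, Term Sg sort s → A.carrier s
  | _, var i => x i
  | _, op σ t => A.op σ fun i => eval A x (t i)

/-- A variable regarded as a term of a sort that is equal to the sort of the variable. -/
def varOfEq (i : ι) {s : S} (h : sort i = s) : Term Sg sort s := h ▸ var i

end Term

namespace SigAlg

variable {ι : Type} {sort : ι → S}

variable (Sg sort) in
/-- The free algebra on a family of sorted generators: the term algebra. -/
def free : SigAlg Sg where
  carrier s := Term Sg sort s
  op σ t := .op σ t

theorem hom_apply_op {A B : SigAlg Sg} (f : A ⟶ B) (σ : Sg.Op) (x : Tuple A.carrier (Sg.src σ)) :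
    f.hom (Sg.tgt σ) (A.op σ x) = B.op σ (fun i => f.hom ((Sg.src σ).get i) (x i)) :=
  f.map_op σ x

/-- The homomorphism on the free algebra that extends an assignment of the generators. -/
def lift {A : SigAlg Sg} (x : ∀ i, A.carrier (sort i)) : free Sg sort ⟶ A where
  hom _ := TypeCat.ofHom fun t => t.eval A x
  map_op _ _ := rfl

theorem free_hom_ext {A : SigAlg Sg} {f g : free Sg sort ⟶ A}
    (h : ∀ i, f.hom (sort i) (.var i) = g.hom (sort i) (.var i)) : f = g := by
  apply Hom.ext
  funext s
  ext t
  induction t with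
  | var i => exact h i
  | op σ t ih =>
    refine (hom_apply_op f σ t).trans (.trans ?_ (hom_apply_op g σ t).symm)
    exact congrArg _ (funext ih)

end SigAlg

/-- The objects of the algebraic theory of a signature: finite contexts of sorted variables. -/
structure Theory (_ : Signature S) : Type u where
  /-- The number of variables. -/
  len : ℕ
  /-- The sorts of the variables. -/
  sort : Fin len → S

/-! ### The theory of contexts and substitutions. -/

namespace Theory

open SigAlg

variable (Sg) in
/-- The context consisting of one variable. -/
def single (s : S) : Theory Sg := ⟨1, fun _ => s⟩

/-- The variable of a context with one variable. -/
def singleVar (s : S) : Term Sg (single Sg s).sort s :=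
  .var (sort := (single Sg s).sort) (0 : Fin 1)

variable (Sg) in
/-- The context given by the source word of an operation symbol. -/
def source (σ : Sg.Op) : Theory Sg := ⟨(Sg.src σ).length, (Sg.src σ).get⟩

/-- The free algebra on a context. -/
abbrev alg (Γ : Theory Sg) : SigAlg Sg := free Sg Γ.sort

theorem single_hom_ext {A : SigAlg Sg} {s : S} {f g : (single Sg s).alg ⟶ A}
    (h : f.hom s (singleVar s) = g.hom s (singleVar s)) : f = g := by
  refine free_hom_ext fun i => ?_
  obtain rfl : i = (0 : Fin 1) := Subsingleton.elim (α := Fin 1) _ _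
  exact h

/-- Morphisms of contexts are homomorphisms of term algebras in the opposite direction, that is,
simultaneous substitutions. -/
instance : SmallCategory (Theory Sg) where
  Hom Γ Δ := Δ.alg ⟶ Γ.alg
  id Γ := 𝟙 Γ.alg
  comp f g := CategoryStruct.comp (obj := SigAlg Sg) g f
  id_comp f := Category.comp_id (obj := SigAlg Sg) f
  comp_id f := Category.id_comp (obj := SigAlg Sg) f
  assoc f g h := (Category.assoc (obj := SigAlg Sg) h g f).symm

/-- The substitution given by a family of terms. -/
def subst {Γ Δ : Theory Sg} (t : ∀ i, Term Sg Γ.sort (Δ.sort i)) : Γ ⟶ Δ :=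
  SigAlg.lift (A := Γ.alg) t

/-- A term as a morphism to a context with one variable. -/
def ofTerm {Γ : Theory Sg} {s : S} (t : Term Sg Γ.sort s) : Γ ⟶ single Sg s :=
  subst fun _ => t

/-- The morphism of contexts that represents an operation symbol. -/
def ofOp (σ : Sg.Op) : source Sg σ ⟶ single Sg (Sg.tgt σ) :=
  ofTerm (.op σ fun i => .var (sort := (source Sg σ).sort) i)

theorem subst_comp_ofTerm_var {Γ Δ : Theory Sg} (t : ∀ i, Term Sg Γ.sort (Δ.sort i))
    (i : Fin Δ.len) : subst t ≫ ofTerm (.var i) = ofTerm (t i) :=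
  free_hom_ext fun _ => rfl

theorem subst_comp_ofOp {Γ : Theory Sg} (σ : Sg.Op)
    (t : ∀ i, Term Sg Γ.sort ((Sg.src σ).get i)) :
    subst (Δ := source Sg σ) t ≫ ofOp σ = ofTerm (.op σ t) :=
  free_hom_ext fun _ => rfl

theorem comp_ofTerm_var {Γ Δ : Theory Sg} (g : Γ ⟶ Δ) (i : Fin Δ.len) :
    g ≫ ofTerm (.var i) = ofTerm (SigAlg.Hom.hom g (Δ.sort i) (.var i)) :=
  free_hom_ext fun _ => rfl

/-! ### Finite products of contexts. -/

section Product

variable {J : Type} [Finite J] (Γ : J → Theory Sg)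

/-- An enumeration of all variables of a finite family of contexts. -/
noncomputable def prodEquiv : Fin (Nat.card (Σ j, Fin (Γ j).len)) ≃ Σ j, Fin (Γ j).len :=
  (Finite.equivFin _).symm

/-- The concatenation of a finite family of contexts. -/
noncomputable def prod : Theory Sg where
  len := Nat.card (Σ j, Fin (Γ j).len)
  sort k := (Γ (prodEquiv Γ k).1).sort (prodEquiv Γ k).2

/-- The variable of the concatenation corresponding to a variable of one of the contexts. -/
noncomputable def prodVar (j : J) (i : Fin (Γ j).len) :
    Term Sg (prod Γ).sort ((Γ j).sort i) :=
  Term.varOfEq (sort := (prod Γ).sort) ((prodEquiv Γ).symm ⟨j, i⟩) 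
    (by
      change (Γ (prodEquiv Γ _).1).sort (prodEquiv Γ _).2 = _
      rw [Equiv.apply_symm_apply])

/-- The projections of the concatenation. -/
noncomputable def prodProj (j : J) : prod Γ ⟶ Γ j := subst (prodVar Γ j)

theorem prodVar_prodEquiv (k : Fin (prod Γ).len) :
    prodVar Γ (prodEquiv Γ k).1 (prodEquiv Γ k).2 = .var (sort := (prod Γ).sort) k := by
  -- The index is generalised so that the cast in `varOfEq` disappears on eliminating `k' = k`.
  have key : ∀ k' (h : (prod Γ).sort k' = (prod Γ).sort k), k' = k →
      Term.varOfEq (Sg := Sg) (sort := (prod Γ).sort) k' h = .var k := by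
    rintro _ _ rfl
    rfl
  exact key _ _ ((prodEquiv Γ).symm_apply_apply k)

variable {Γ} {A : SigAlg Sg}

/-- The homomorphism on the term algebra of a concatenation given by homomorphisms on the
term algebras of the contexts. -/
noncomputable def prodDesc (g : ∀ j, (Γ j).alg ⟶ A) : (prod Γ).alg ⟶ A :=
  SigAlg.lift fun k => (g (prodEquiv Γ k).1).hom _ (.var (prodEquiv Γ k).2)

theorem prodProj_prodDesc (g : ∀ j, (Γ j).alg ⟶ A) (j : J) :
    CategoryStruct.comp (obj := SigAlg Sg) (prodProj Γ j) (prodDesc g) = g j := by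
  refine free_hom_ext fun i => ?_
  have key : ∀ (k : Fin (prod Γ).len) (p : Σ j, Fin (Γ j).len)
      (h : (prod Γ).sort k = (Γ p.1).sort p.2), prodEquiv Γ k = p →
      (prodDesc g).hom _ (Term.varOfEq k h) = (g p.1).hom _ (.var p.2) := by
    rintro k _ _ rfl
    rfl
  exact key _ ⟨j, i⟩ _ ((prodEquiv Γ).apply_symm_apply _)

theorem prod_hom_ext {f g : (prod Γ).alg ⟶ A}
    (h : ∀ j, CategoryStruct.comp (obj := SigAlg Sg) (prodProj Γ j) f =
      CategoryStruct.comp (obj := SigAlg Sg) (prodProj Γ j) g) : f = g := by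
  refine free_hom_ext fun k => ?_
  have := ConcreteCategory.congr_hom
    (congrFun (congrArg SigAlg.Hom.hom (h (prodEquiv Γ k).1)) _) (.var (prodEquiv Γ k).2)
  have e : (SigAlg.Hom.hom (prodProj Γ (prodEquiv Γ k).1)) _ (.var (prodEquiv Γ k).2) =
    .var (sort := (prod Γ).sort) k := prodVar_prodEquiv Γ k
  have e' : ∀ l : (prod Γ).alg ⟶ A,
      (CategoryStruct.comp (obj := SigAlg Sg) (prodProj Γ (prodEquiv Γ k).1) l).hom _
        (.var (prodEquiv Γ k).2) = l.hom _ (.var (sort := (prod Γ).sort) k) :=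
    fun l => congrArg (l.hom _) e
  exact (e' f).symm.trans (this.trans (e' g))

variable (Γ) in
/-- The concatenation of contexts is their product in the theory. -/
noncomputable def prodIsLimit : IsLimit (Fan.mk (prod Γ) (prodProj Γ)) :=
  Fan.IsLimit.mk _ (fun s => prodDesc (A := s.pt.alg) s.proj)
    (fun s j => prodProj_prodDesc (A := s.pt.alg) s.proj j)
    (fun s _ hm => prod_hom_ext (A := s.pt.alg) fun j =>
      (hm j).trans (prodProj_prodDesc (A := s.pt.alg) s.proj j).symm)

end Product

instance : HasFiniteProducts (Theory Sg) where
  out _ :=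
    { has_limit := fun K =>
        have : HasLimit (Discrete.functor (K.obj ∘ Discrete.mk)) := ⟨⟨⟨_, prodIsLimit _⟩⟩⟩
        hasLimit_of_iso Discrete.natIsoFunctor.symm }

/-- A context is the product of its variables. -/
def varIsLimit (Γ : Theory Sg) :
    IsLimit (Fan.mk (f := fun i => single Sg (Γ.sort i)) Γ fun i => ofTerm (.var i)) :=
  Fan.IsLimit.mk _ (fun s => subst fun i => SigAlg.Hom.hom (s.proj i) _ (singleVar _))
    (fun _ _ => (subst_comp_ofTerm_var _ _).trans (single_hom_ext rfl))
    (fun s _ hm => free_hom_ext fun i =>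
      congrArg (fun l : s.pt ⟶ single Sg (Γ.sort i) => SigAlg.Hom.hom l _ (singleVar _)) (hm i))

/-- The model of the theory given by an algebra `A`: a context is sent to the homomorphisms from
its term algebra to `A`. -/
def model (A : SigAlg Sg) : Theory Sg ⥤ Type u where
  obj Γ := Γ.alg ⟶ A
  map g := TypeCat.ofHom fun h => CategoryStruct.comp (obj := SigAlg Sg) g h
  map_id Γ := by
    ext h
    exact Category.id_comp (obj := SigAlg Sg) h
  map_comp f g := by
    ext h
    exact Category.assoc (obj := SigAlg Sg) g f h

/-- A product of contexts is a coproduct of free algebras, which `Hom(-, A)` turns into a product.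
-/
instance (A : SigAlg Sg) : PreservesFiniteProducts (model A) where
  preserves n := by
    have (Γ : Fin n → Theory Sg) : PreservesLimit (Discrete.functor Γ) (model A) :=
      preservesLimit_of_preserves_limit_cone (prodIsLimit Γ)
        ((isLimitMapConeFanMkEquiv _ _ _).symm (Fan.IsLimit.mk _
          (fun s => TypeCat.ofHom fun x => prodDesc fun j => s.proj j x)
          (fun s j => by
            ext x
            exact prodProj_prodDesc _ j)
          (fun s m hm => by
            ext x
            refine prod_hom_ext fun j => ?_
            exact (ConcreteCategory.congr_hom (hm j) x).trans
              (prodProj_prodDesc (fun j => s.proj j x) j).symm)))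
    exact preservesLimitsOfShape_of_discrete _

variable (Sg) in
/-- The functor from algebras to models of the theory. -/
def modelFunctor : SigAlg Sg ⥤ AlgOver (Theory Sg) where
  obj A := ⟨model A, inferInstance⟩
  map f := ObjectProperty.homMk
    { app := fun Γ => TypeCat.ofHom fun h => h ≫ f
      naturality := fun Γ Δ g => by
        ext h
        exact Category.assoc (obj := SigAlg Sg) g h f }
  map_id A := by
    ext Γ h
    exact Category.comp_id (obj := SigAlg Sg) h
  map_comp f g := by
    ext Γ h
    exact (Category.assoc (obj := SigAlg Sg) h f g).symm

/-- The homomorphism from a free algebra on one generator given by an element. -/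
def point {A : SigAlg Sg} {s : S} (a : A.carrier s) : (single Sg s).alg ⟶ A :=
  SigAlg.lift fun _ => a

theorem point_apply_var {A : SigAlg Sg} {s : S} (h : (single Sg s).alg ⟶ A) :
    point (h.hom s (singleVar s)) = h :=
  single_hom_ext rfl

/-- The value `f a` is recovered from `point a ≫ f` at the sole generator. -/
instance : (modelFunctor Sg).Faithful where
  map_injective {A B f g} h := by
    apply SigAlg.Hom.ext
    funext s
    ext a
    have h' : ((modelFunctor Sg).map f).hom = ((modelFunctor Sg).map g).hom := by rw [h]
    have : point a ≫ f = point a ≫ g :=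
      ConcreteCategory.congr_hom (NatTrans.congr_app h' (single Sg s)) (point a)
    exact ConcreteCategory.congr_hom (congrFun (congrArg SigAlg.Hom.hom this) s)
      (singleVar s)

/-! ### Fullness. -/

section Full

variable {A B : SigAlg Sg} (τ : model A ⟶ model B)

theorem natTrans_naturality {Γ Δ : Theory Sg} (g : Γ ⟶ Δ) (h : Γ.alg ⟶ A) :
    τ.app Δ (CategoryStruct.comp (obj := SigAlg Sg) g h) =
      CategoryStruct.comp (obj := SigAlg Sg) g (τ.app Γ h) :=
  ConcreteCategory.congr_hom (τ.naturality g) h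

/-- This is naturality along `ofTerm t`, so one-variable components determine `τ`. -/
theorem natTrans_app_hom {Γ : Theory Sg} (h : Γ.alg ⟶ A) {s : S} (t : Term Sg Γ.sort s) :
    SigAlg.Hom.hom (τ.app Γ h) s t =
      SigAlg.Hom.hom (τ.app (single Sg s) (point (h.hom s t))) s
        (singleVar s) := by
  have e : point (h.hom s t) = CategoryStruct.comp (obj := SigAlg Sg) (ofTerm t) h :=
    free_hom_ext fun _ => rfl
  rw [e, natTrans_naturality]
  rfl

/-- The homomorphism that induces a given morphism of models. -/
def homOfNatTrans : A ⟶ B where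
  hom s := TypeCat.ofHom fun a => SigAlg.Hom.hom (τ.app (single Sg s) (point a)) s
    (singleVar s)
  map_op σ x := by
    let h : (source Sg σ).alg ⟶ A := SigAlg.lift x
    -- The generic term `σ(x₀, …)` has value `A.op σ x` under `h`.
    refine (natTrans_app_hom τ h (.op σ fun i => .var i)).symm.trans ?_
    refine (hom_apply_op _ _ _).trans (congrArg _ (funext fun i => ?_))
    exact natTrans_app_hom τ h (.var i)

end Full

instance : (modelFunctor Sg).Full where
  map_surjective {A B} τ := by
    refine ⟨homOfNatTrans τ.hom, ?_⟩
    ext Γ h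
    refine free_hom_ext fun i => ?_
    exact (natTrans_app_hom τ.hom h (.var i)).symm

/-- Elements of a set are maps from a one-point set, to which the universal property applies. -/
theorem bijective_proj_of_isLimit {J : Type} {X : J → Type u} {c : Fan X} (hc : IsLimit c) :
    Function.Bijective fun (x : c.pt) (j : J) => c.proj j x := by
  constructor
  · intro x y h
    have : (TypeCat.ofHom fun _ => x : PUnit.{u + 1} ⟶ c.pt) = TypeCat.ofHom fun _ => y :=
      Fan.IsLimit.hom_ext hc _ _ fun j => by
        ext
        exact congrFun h j
    exact ConcreteCategory.congr_hom this PUnit.unit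
  · intro y
    refine ⟨Fan.IsLimit.lift hc (fun j => (TypeCat.ofHom fun _ => y j : PUnit.{u + 1} ⟶ X j))
      PUnit.unit, funext fun j => ?_⟩
    exact ConcreteCategory.congr_hom (Fan.IsLimit.fac hc
      (fun j => (TypeCat.ofHom fun _ => y j : PUnit.{u + 1} ⟶ X j)) j) PUnit.unit

/-! ### Essential surjectivity. -/

section EssSurj

variable (M : Theory Sg ⥤ Type u) [PreservesFiniteProducts M]

theorem bijective_map_var (Γ : Theory Sg) :
    Function.Bijective fun (m : M.obj Γ) (i : Fin Γ.len) =>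
      (M.map (ofTerm (.var i) : Γ ⟶ single Sg (Γ.sort i)) m : M.obj (single Sg (Γ.sort i))) :=
  bijective_proj_of_isLimit
    (isLimitMapConeFanMkEquiv M _ _ (isLimitOfPreserves M (varIsLimit Γ)))

/-- The elements of a model at a context are the assignments of the variables. -/
noncomputable def assignmentEquiv (Γ : Theory Sg) :
    M.obj Γ ≃ ∀ i, M.obj (single Sg (Γ.sort i)) :=
  Equiv.ofBijective _ (bijective_map_var M Γ)

/-- The algebra underlying a model of the theory. -/
noncomputable def algebraOfModel : SigAlg Sg where
  carrier s := M.obj (single Sg s)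
  op σ x := M.map (ofOp σ) ((assignmentEquiv M (source Sg σ)).symm x)

/-- The homomorphism given by an element of a model. -/
noncomputable def homOfElement {Γ : Theory Sg} (m : M.obj Γ) : Γ.alg ⟶ algebraOfModel M :=
  SigAlg.lift (assignmentEquiv M Γ m)

theorem homOfElement_apply {Γ : Theory Sg} (m : M.obj Γ) {s : S} (t : Term Sg Γ.sort s) :
    (homOfElement M m).hom s t = M.map (ofTerm t) m := by
  induction t with
  | var i => rfl
  | op σ t ih =>
    rw [← subst_comp_ofOp, M.map_comp]
    -- It remains to see that the element `M.map (subst t) m` has the values of the `t i` as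
    -- coordinates.
    refine congrArg (M.map (ofOp σ)) ((Equiv.symm_apply_eq _).2 (funext fun i => ?_))
    refine (ih i).trans ?_
    exact ConcreteCategory.congr_hom ((congrArg M.map
      (subst_comp_ofTerm_var (Δ := source Sg σ) t i)).symm.trans (M.map_comp _ _)) m

/-- Both sides are assignments of the variables: elements by product preservation, homomorphisms by
freeness. -/
theorem bijective_homOfElement (Γ : Theory Sg) :
    Function.Bijective fun m : M.obj Γ => homOfElement M m := by
  constructor
  · intro m n h
    refine (assignmentEquiv M Γ).injective (funext fun i => ?_)
    exact ConcreteCategory.congr_hom (congrFun (congrArg SigAlg.Hom.hom h) (Γ.sort i)) (.var i)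
  · intro h
    refine ⟨(assignmentEquiv M Γ).symm fun i => h.hom _ (.var i), free_hom_ext fun i => ?_⟩
    exact congrFun ((assignmentEquiv M Γ).apply_symm_apply fun i => h.hom _ (.var i)) i

/-- A model is isomorphic to the one given by its underlying algebra. -/
noncomputable def modelIso : M ≅ model (algebraOfModel M) :=
  NatIso.ofComponents (fun Γ => (Equiv.ofBijective _ (bijective_homOfElement M Γ)).toIso)
    fun {Γ Δ} g => by
      ext m
      refine free_hom_ext fun i => ?_
      refine Eq.trans ?_ (homOfElement_apply M m (SigAlg.Hom.hom g _ (.var i))).symm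
      rw [← comp_ofTerm_var, M.map_comp]
      rfl

end EssSurj

instance : (modelFunctor Sg).EssSurj where
  mem_essImage M := by
    have : PreservesFiniteProducts M.obj := M.property
    exact ⟨algebraOfModel M.obj, ⟨ObjectProperty.isoMk _ (modelIso M.obj).symm⟩⟩

instance : (modelFunctor Sg).IsEquivalence where

end Theory

theorem SigAlg.isAlgebraicCategory (Sg : Signature S) : IsAlgebraicCategory (SigAlg Sg) :=
  ⟨Theory Sg, inferInstance, inferInstance, ⟨(Theory.modelFunctor Sg).asEquivalence⟩⟩

end Terms

end InserterCat

theorem mainTheorem7 {S : Type u} (Sg : InserterCat.Signature S) :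
    InserterCat.IsInserter.{w', w} (F := InserterCat.sHat Sg) (G := InserterCat.tHat Sg)
      (InserterCat.SigAlg.forget Sg) (InserterCat.SigAlg.operations Sg) ∧
    InserterCat.ConcretelyIsomorphic (InserterCat.SigAlg.forget Sg)
      (InserterCat.Ins.forget (InserterCat.sHat Sg) (InserterCat.tHat Sg)) ∧
    InserterCat.IsAlgebraicCategory
      (InserterCat.Ins (InserterCat.sHat Sg) (InserterCat.tHat Sg)) ∧
    InserterCat.IsAlgebraicCategory (InserterCat.SigAlg Sg) :=
  ⟨InserterCat.SigAlg.isInserter Sg, InserterCat.SigAlg.concretelyIsomorphic_ins Sg,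
    .of_equivalence (InserterCat.SigAlg.insEquivalence Sg) (InserterCat.SigAlg.isAlgebraicCategory Sg),
    InserterCat.SigAlg.isAlgebraicCategory Sg⟩
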